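/- Let $\mathcal X$ be a compact subset of a real normed space, let $\mu$ be a $\sigma$-finite measure on a measurable space $\mathcal Y$, let $M$ be a real number, let $\{f_t : t\in[-M,M]\}$ be a family of probability densities with respect to $\mu$ such that $(t,y)\mapsto f_t(y)$ is measurable, and for each $x\in\mathcal X$ let $f_{0x}$ be a probability density with respect to $\mu$. Write $\mathbb E_x$ for expectation under $f_{0x}$. Let $x_1,x_2,\dots\in\mathcal X$ be a fixed design, and let $Y_1,Y_2,\dots$ be independent with $Y_i\sim f_{0x_i}$; $\mathbb P_0$ denotes the law of $(Y_i)_{i\ge1}$, i.e. the infinite product of the laws $f_{0x_i}\,d\mu$. Let $\Theta$ be a set of continuous functions $\mathcal X\to[-M,M]$ that is compact in the sup norm, let $\Pi$ be a Borel probability measure (the prior) on $\Theta$, and let $\theta^*\in\Theta$. Assume: (B) for all $x_0\in\mathcal X$ and $r>0$, $\displaystyle\liminf_{n\to\infty}\frac1n\#\{i\le n:\|x_i-x_0\|<r\}>0$; (C) for every $x\in\mathcal X$, $\theta^*(x)$ minimises over $t\in[-M,M]$ the Kullback–Leibler divergence $\mathbb E_x\log\frac{f_{0x}}{f_t}\in[0,\infty]$,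 and for every $\eta>0$, $\Pi\big(\theta:\sup_x|\theta(x)-\theta^*(x)|<\eta\big)>0$; (D) for all $x\in\mathcal X$ and $t\in[-M,M]$, $f_t>0$ holds almost surely under $f_{0x}$; the expectations $\mathbb E_x\big[\log\frac{f_t}{f_{t'}}\big]$ and, for every $\alpha\in[0,1]$, $\mathbb E_x\big[(\frac{f_t}{f_{t'}})^\alpha\big]$ exist, are finite and are continuous in $(x,t,t')\in\mathcal X\times[-M,M]^2$; and $\mathbb E_x\big[\log^2\frac{f_t}{f_{t'}}\big]$ is uniformly bounded on $\mathcal X\times[-M,M]^2$; (E) for every $\epsilon>0$ there is $\delta\in(0,1)$ such that for all $x\in\mathcal X$ and $t\in[-M,M]$, $\mathbb E_x\log\frac{f_{\theta^*(x)}}{f_t}<\delta$ implies $|t-\theta^*(x)|<\epsilon$. For measurable $A\subseteq\Theta$ define the posterior probability $$\Pi(A\mid Y_{1:n})=\frac{\int_A\prod_{i=1}^n\frac{f_{\theta(x_i)}(Y_i)}{f_{\theta^*(x_i)}(Y_i)}\,d\Pi(\theta)}{\int_\Theta\prod_{i=1}^n\frac{f_{\theta(x_i)}(Y_i)}{f_{\theta^*(x_i)}(Y_i)}\,d\Pi(\theta)}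 .$$ Then for every $\epsilon>0$, $\mathbb P_0$-almost surely: the denominator is positive and finite for every $n$ (so the posterior is well defined), and $$\Pi\Big(\Big\{\theta\in\Theta:\sup_{x\in\mathcal X}|\theta(x)-\theta^*(x)|>\epsilon\Big\}\,\Big|\,Y_{1:n}\Big)\longrightarrow0\qquad(n\to\infty).$$ -/

import Mathlib

open MeasureTheory Filter Topology
open scoped ENNReal

/-- A probability density with respect to the measure `μ`. -/
structure ProbDensity {Y : Type*} [MeasurableSpace Y] (μ : Measure Y) where
  toFun : Y → ℝ
  measurable_toFun : Measurable toFun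
  nonneg : ∀ y, 0 ≤ toFun y
  lintegral_eq_one : ∫⁻ y, ENNReal.ofReal (toFun y) ∂μ = 1

namespace ProbDensity

variable {Y : Type*} [MeasurableSpace Y] {μ : Measure Y}

instance : CoeFun (ProbDensity μ) (fun _ => Y → ℝ) := ⟨toFun⟩

/-- The probability measure `g dμ` of a density `g`. -/
noncomputable def law (g : ProbDensity μ) : Measure Y :=
  μ.withDensity (fun y => ENNReal.ofReal (g y))

instance (g : ProbDensity μ) : IsProbabilityMeasure g.law :=
  ⟨by rw [law, withDensity_apply _ MeasurableSet.univ, Measure.restrict_univ]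
      exact g.lintegral_eq_one⟩

end ProbDensity

namespace INID

section Model

variable {E : Type*} [NormedAddCommGroup E] {X : Set E}
  {Y : Type*} [MeasurableSpace Y] {μ : Measure Y} {M : ℝ}

/-- The sup-norm distance `sup_x |θ x - θ' x|` of two functions with values in `[-M, M]`. -/
noncomputable def supDist (θ θ' : C(X, Set.Icc (-M) M)) : ℝ :=
  ⨆ z : X, |(θ z : ℝ) - (θ' z : ℝ)|

/-- The design visits every ball `{z : ‖z - x₀‖ < r}` with positive lower frequency. -/
def DesignCondition (x : ℕ → X) : Prop :=
  ∀ x₀ : X, ∀ r : ℝ, 0 < r →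
    0 < liminf (fun n : ℕ => (1 / (n : ℝ)) *
      ∑ i ∈ Finset.range n, Set.indicator {z : E | ‖z - x₀‖ < r} (fun _ => (1 : ℝ)) (x i)) atTop

/-- At every covariate value `z`, the parameter `θ* z` minimises over `t ∈ [-M, M]` the
Kullback-Leibler divergence `E_z log (f₀_z / f_t)`. -/
def IsKLMinimizer (f₀ : X → ProbDensity μ) (f : Set.Icc (-M) M → ProbDensity μ)
    (θstar : C(X, Set.Icc (-M) M)) : Prop :=
  ∀ z : X, ∀ t : Set.Icc (-M) M,
    InformationTheory.klDiv (f₀ z).law (f (θstar z)).law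
      ≤ InformationTheory.klDiv (f₀ z).law (f t).law

/-- `θ*` lies in the sup-norm support of the prior on `Θ`. -/
def InSupNormSupport {Θ : Set C(X, Set.Icc (-M) M)} [MeasurableSpace C(X, Set.Icc (-M) M)]
    (prior : Measure Θ) (θstar : Θ) : Prop :=
  ∀ η : ℝ, 0 < η → 0 < prior {θ : Θ | supDist (θ : C(X, Set.Icc (-M) M)) θstar < η}

/-- Continuity and moment conditions on the likelihood ratios `f_t / f_t'` under `f₀_z`.
The first clause and the integrability clauses say that the expectations that follow are
well defined and finite: `log (f_t / f_t')` is a finite number almost surely only where both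
densities are positive. -/
structure RatioRegularity (f₀ : X → ProbDensity μ) (f : Set.Icc (-M) M → ProbDensity μ) :
    Prop where
  ae_pos : ∀ (z : X) (t : Set.Icc (-M) M), ∀ᵐ y ∂(f₀ z).law, 0 < f t y
  integrable_log : ∀ (z : X) (t t' : Set.Icc (-M) M),
    Integrable (fun y => Real.log (f t y / f t' y)) (f₀ z).law
  continuous_log : Continuous fun p : X × Set.Icc (-M) M × Set.Icc (-M) M =>
    ∫ y, Real.log (f p.2.1 y / f p.2.2 y) ∂(f₀ p.1).law
  integrable_rpow : ∀ α ∈ Set.Icc (0 : ℝ) 1, ∀ (z : X) (t t' : Set.Icc (-M) M),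
    Integrable (fun y => (f t y / f t' y) ^ α) (f₀ z).law
  continuous_rpow : ∀ α ∈ Set.Icc (0 : ℝ) 1,
    Continuous fun p : X × Set.Icc (-M) M × Set.Icc (-M) M =>
      ∫ y, (f p.2.1 y / f p.2.2 y) ^ α ∂(f₀ p.1).law
  integrable_log_sq : ∀ (z : X) (t t' : Set.Icc (-M) M),
    Integrable (fun y => Real.log (f t y / f t' y) ^ 2) (f₀ z).law
  log_sq_bounded : ∃ C : ℝ, ∀ (z : X) (t t' : Set.Icc (-M) M),
    ∫ y, Real.log (f t y / f t' y) ^ 2 ∂(f₀ z).law ≤ C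

/-- Separation of parameter values by the Kullback-Leibler excess, uniformly in `z`. -/
def KLSeparation (f₀ : X → ProbDensity μ) (f : Set.Icc (-M) M → ProbDensity μ)
    (θstar : C(X, Set.Icc (-M) M)) : Prop :=
  ∀ ε : ℝ, 0 < ε → ∃ δ ∈ Set.Ioo (0 : ℝ) 1, ∀ (z : X) (t : Set.Icc (-M) M),
    ∫ y, Real.log (f (θstar z) y / f t y) ∂(f₀ z).law < δ → |(t : ℝ) - (θstar z : ℝ)| < ε

/-- The likelihood ratio `∏_{i < n} f_{θ (x i)} (y i) / f_{θ* (x i)} (y i)`. -/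
noncomputable def likelihoodRatio (f : Set.Icc (-M) M → ProbDensity μ) (x : ℕ → X)
    (θstar θ : C(X, Set.Icc (-M) M)) (n : ℕ) (y : ℕ → Y) : ℝ :=
  ∏ i ∈ Finset.range n, f (θ (x i)) (y i) / f (θstar (x i)) (y i)

/-- The integral of the likelihood ratio over `A` with respect to the prior. -/
noncomputable def partialEvidence {Θ : Set C(X, Set.Icc (-M) M)}
    [MeasurableSpace C(X, Set.Icc (-M) M)] (f : Set.Icc (-M) M → ProbDensity μ) (x : ℕ → X)
    (prior : Measure Θ) (θstar : Θ) (A : Set Θ) (n : ℕ) (y : ℕ → Y) : ℝ≥0∞ :=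
  ∫⁻ θ in A, ENNReal.ofReal (likelihoodRatio f x θstar θ n y) ∂prior

/-- The posterior probability of `A` given the first `n` responses. -/
noncomputable def posterior {Θ : Set C(X, Set.Icc (-M) M)}
    [MeasurableSpace C(X, Set.Icc (-M) M)] (f : Set.Icc (-M) M → ProbDensity μ) (x : ℕ → X)
    (prior : Measure Θ) (θstar : Θ) (A : Set Θ) (n : ℕ) (y : ℕ → Y) : ℝ≥0∞ :=
  partialEvidence f x prior θstar A n y / partialEvidence f x prior θstar Set.univ n y

/-- The law of the sequence of independent responses `Y i ∼ f₀_{x i}`. -/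
noncomputable def trueLaw (f₀ : X → ProbDensity μ) (x : ℕ → X) : Measure (ℕ → Y) :=
  Measure.infinitePi fun i => (f₀ (x i)).law

end Model

end INID

/-! Write `L n a b` for the likelihood ratio of `b` against `a`. Numerator and denominator of the
posterior are compared on exponential scales, using only Tonelli, Markov-type moment bounds and
Borel-Cantelli.

Numerator: fix `θ₁ ≠ θ*`. The mean of `log (f_θ₁ / f_θ*)` is continuous in the covariate, nowhere
positive and negative somewhere, so its sums along the design fall linearly. For a small power `β`,
the `β`-moment of one factor is at most `1 + β (mean log + s)` uniformly in the covariate (Dini), so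
`L n θ* θ₁` decays exponentially almost surely. The factorisation `L n θ* θ = L n θ* θ₁ * L n θ₁ θ`
carries this to a small ball around `θ₁`, since the second factor has mean growing at an arbitrarily
small rate there. Compactness then covers the complement of any ball around `θ*`
(`exists_ae_tendsto_exp_mul_partialEvidence`).

Denominator: near `θ*` the inverse ratios also have slowly growing means, and `u + 1/u ≥ 1` turns
this into a lower bound that beats every negative exponential
(`exists_ae_eventually_le_exp_mul_partialEvidence`). -/

namespace INID

/-! ### Exponential Borel-Cantelli and small-power moments -/

/-- Borel-Cantelli with an exponential rate. -/
theorem ae_tendsto_exp_mul_of_lintegral_le {Ω : Type*} [MeasurableSpace Ω] {P : Measure Ω}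
    {F : ℕ → Ω → ℝ≥0∞} (hF : ∀ n, Measurable (F n)) {C : ℝ≥0∞} (hC : C ≠ ∞) {a b : ℝ}
    (hab : a < b) (h : ∀ n, ∫⁻ ω, F n ω ∂P ≤ ENNReal.ofReal (Real.exp (n * a)) * C) :
    ∀ᵐ ω ∂P, Tendsto (fun n : ℕ => ENNReal.ofReal (Real.exp (-(n * b))) * F n ω) atTop (𝓝 0) := by
  have hsum : ∑' n : ℕ, ∫⁻ ω, ENNReal.ofReal (Real.exp (-(n * b))) * F n ω ∂P ≠ ∞ := by
    have hle (n : ℕ) : ∫⁻ ω, ENNReal.ofReal (Real.exp (-(n * b))) * F n ω ∂P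
        ≤ ENNReal.ofReal (Real.exp (a - b)) ^ n * C := by
      rw [lintegral_const_mul _ (hF n)]
      refine (mul_le_mul_right (h n) _).trans ?_
      rw [← mul_assoc, ← ENNReal.ofReal_mul (Real.exp_nonneg _), ← Real.exp_add,
        ← ENNReal.ofReal_pow (Real.exp_nonneg _), ← Real.exp_nat_mul]
      refine le_of_eq ?_
      congr 3
      ring
    refine ne_top_of_le_ne_top ?_ (ENNReal.tsum_le_tsum hle)
    rw [ENNReal.tsum_mul_right, ENNReal.tsum_geometric]
    refine ENNReal.mul_ne_top (ENNReal.inv_ne_top.2 (tsub_pos_of_lt ?_).ne') hC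
    rw [ENNReal.ofReal_lt_one, Real.exp_lt_one_iff]
    linarith
  rw [← lintegral_tsum (fun n => ((hF n).const_mul _).aemeasurable)] at hsum
  filter_upwards [ae_lt_top (Measurable.tsum fun n => (hF n).const_mul _) hsum] with ω hω
  exact ENNReal.tendsto_atTop_zero_of_tsum_ne_top hω.ne

theorem tendsto_rpow_sub_one_div {g : ℝ} (hg : 0 < g) :
    Tendsto (fun n : ℕ => (g ^ (1 / ((n : ℝ) + 1)) - 1) / (1 / ((n : ℝ) + 1))) atTop
      (𝓝 (Real.log g)) := by
  have hd : HasDerivAt (fun b : ℝ => g ^ b) (Real.log g) 0 := by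
    simpa using (Real.hasStrictDerivAt_const_rpow hg 0).hasDerivAt
  have := hd.tendsto_slope_zero
  have ht : Tendsto (fun n : ℕ => 1 / ((n : ℝ) + 1)) atTop (𝓝[≠] 0) :=
    tendsto_nhdsWithin_iff.2 ⟨tendsto_one_div_add_atTop_nhds_zero_nat,
      Eventually.of_forall fun n => by simp only [Set.mem_compl_iff, Set.mem_singleton_iff]; positivity⟩
  refine (this.comp ht).congr fun n => ?_
  simp [div_eq_inv_mul]

/-- Bernoulli's inequality for `g ^ a` with exponent `b / a ≥ 1`. This supplies the monotonicity
needed for Dini's theorem. -/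
theorem rpow_sub_one_div_le {g : ℝ} (hg : 0 < g) {a b : ℝ} (ha : 0 < a) (hab : a ≤ b) :
    (g ^ a - 1) / a ≤ (g ^ b - 1) / b := by
  have hb : 0 < b := ha.trans_le hab
  have h := one_add_mul_self_le_rpow_one_add (s := g ^ a - 1) (p := b / a)
    (by linarith [Real.rpow_pos_of_pos hg a]) ((one_le_div ha).2 hab)
  rw [add_sub_cancel, ← Real.rpow_mul hg.le, mul_div_cancel₀ _ ha.ne'] at h
  rw [div_le_div_iff₀ ha hb]
  have : b / a * (g ^ a - 1) * a = b * (g ^ a - 1) := by field_simp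
  nlinarith

theorem log_le_rpow_sub_one_div {g : ℝ} (hg : 0 < g) {a : ℝ} (ha : 0 < a) :
    Real.log g ≤ (g ^ a - 1) / a := by
  rw [le_div_iff₀ ha, mul_comm, ← Real.log_rpow hg]
  exact Real.log_le_sub_one_of_pos (Real.rpow_pos_of_pos hg a)

/-- Small powers of a positive function have moments governed by the mean logarithm, uniformly over
a compact family of probability measures with continuous moments. -/
theorem exists_integral_rpow_le_of_continuous {α Ω : Type*} [TopologicalSpace α] [CompactSpace α]
    [MeasurableSpace Ω] {P : α → Measure Ω} [∀ z, IsProbabilityMeasure (P z)] {g : α → Ω → ℝ}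
    (hpos : ∀ z, ∀ᵐ y ∂P z, 0 < g z y)
    (hlog : ∀ z, Integrable (fun y => Real.log (g z y)) (P z))
    (hlogc : Continuous fun z => ∫ y, Real.log (g z y) ∂P z)
    (hrpow : ∀ β ∈ Set.Icc (0 : ℝ) 1, ∀ z, Integrable (fun y => g z y ^ β) (P z))
    (hrpowc : ∀ β ∈ Set.Icc (0 : ℝ) 1, Continuous fun z => ∫ y, g z y ^ β ∂P z)
    {s : ℝ} (hs : 0 < s) :
    ∃ β : ℝ, 0 < β ∧ β ≤ 1 ∧ ∀ z, ∫ y, g z y ^ β ∂P z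
      ≤ 1 + β * (∫ y, Real.log (g z y) ∂P z + s) := by
  have hb (n : ℕ) : 0 < 1 / ((n : ℝ) + 1) := by positivity
  have hb1 (n : ℕ) : 1 / ((n : ℝ) + 1) ≤ 1 := by
    rw [div_le_one (by positivity)]; linarith [n.cast_nonneg (α := ℝ)]
  have hint {β : ℝ} (h0 : 0 < β) (h1 : β ≤ 1) (z : α) :
      Integrable (fun y => (g z y ^ β - 1) / β) (P z) :=
    ((hrpow β ⟨h0.le, h1⟩ z).sub (integrable_const _)).div_const _
  have heq {β : ℝ} (h0 : 0 < β) (h1 : β ≤ 1) (z : α) :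
      ∫ y, (g z y ^ β - 1) / β ∂P z = (∫ y, g z y ^ β ∂P z - 1) / β := by
    rw [integral_div, integral_sub (hrpow β ⟨h0.le, h1⟩ z) (integrable_const _), integral_const,
      probReal_univ, one_smul]
  -- Dini's theorem: as the power `1 / (n + 1)` decreases to zero, the difference quotients decrease
  -- to the continuous mean logarithm, so one power serves all `z`.
  have key := Antitone.tendstoUniformly_of_forall_tendsto
    (F := fun (n : ℕ) z => ∫ y, (g z y ^ (1 / ((n : ℝ) + 1)) - 1) / (1 / ((n : ℝ) + 1)) ∂P z)
    (f := fun z => ∫ y, Real.log (g z y) ∂P z) ?_ ?_ hlogc ?_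
  · obtain ⟨n, hn⟩ := (Metric.tendstoUniformly_iff.1 key s hs).exists
    refine ⟨1 / ((n : ℝ) + 1), hb n, hb1 n, fun z => ?_⟩
    have h := hn z
    rw [Real.dist_eq, abs_sub_comm, heq (hb n) (hb1 n)] at h
    have h := (le_abs_self _).trans h.le
    rw [sub_le_iff_le_add', div_le_iff₀ (hb n)] at h
    linarith
  · intro n
    simp_rw [heq (hb n) (hb1 n)]
    exact ((hrpowc _ ⟨(hb n).le, hb1 n⟩).sub continuous_const).div_const _
  · intro m n hmn z
    refine integral_mono_ae (hint (hb n) (hb1 n) z) (hint (hb m) (hb1 m) z) ?_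
    filter_upwards [hpos z] with y hy
    exact rpow_sub_one_div_le hy (hb n) (one_div_le_one_div_of_le (by positivity) (by gcongr))
  · intro z
    -- Every quotient lies between `log g` and its value `g - 1` at power one.
    refine tendsto_integral_of_dominated_convergence
      (fun y => |Real.log (g z y)| + |(g z y ^ (1 : ℝ) - 1) / 1|)
      (fun n => (hint (hb n) (hb1 n) z).aestronglyMeasurable) ?_ (fun n => ?_) ?_
    · exact (hlog z).abs.add (hint one_pos le_rfl z).abs
    · filter_upwards [hpos z] with y hy
      have h1 := log_le_rpow_sub_one_div hy (hb n)
      have h2 := rpow_sub_one_div_le hy (hb n) (hb1 n)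
      rw [Real.norm_eq_abs, abs_le]
      constructor
      · linarith [neg_abs_le (Real.log (g z y)), abs_nonneg ((g z y ^ (1 : ℝ) - 1) / 1)]
      · linarith [abs_nonneg (Real.log (g z y)), le_abs_self ((g z y ^ (1 : ℝ) - 1) / 1)]
    · filter_upwards [hpos z] with y hy using tendsto_rpow_sub_one_div hy

theorem lintegral_prod_infinitePi {Y : Type*} [MeasurableSpace Y] {ν : ℕ → Measure Y}
    [∀ i, IsProbabilityMeasure (ν i)] {g : ℕ → Y → ℝ≥0∞} (hg : ∀ i, Measurable (g i)) (n : ℕ) :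
    ∫⁻ y, ∏ i ∈ Finset.range n, g i (y i) ∂Measure.infinitePi ν
      = ∏ i ∈ Finset.range n, ∫⁻ u, g i u ∂ν i := by
  have hind := ProbabilityTheory.iIndepFun_infinitePi (P := ν) (X := fun i => g i) hg
  refine (ProbabilityTheory.lintegral_prod_eq_prod_lintegral_of_indepFun (Finset.range n)
    (fun i (y : ℕ → Y) => g i (y i)) hind (fun i => (hg i).comp (measurable_pi_apply i))).trans ?_
  exact Finset.prod_congr rfl fun i _ => (measurePreserving_eval_infinitePi ν i).lintegral_comp (hg i)

/-! ### Moments and measurability of likelihood ratios -/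

section Model

variable {E : Type*} [NormedAddCommGroup E] {X : Set E}
  {Y : Type*} [MeasurableSpace Y] {μ : Measure Y} {M : ℝ}
  {f₀ : X → ProbDensity μ} {f : Set.Icc (-M) M → ProbDensity μ} {x : ℕ → X}

instance : IsProbabilityMeasure (trueLaw f₀ x) := by
  unfold trueLaw; infer_instance

theorem measurable_ratio (f : Set.Icc (-M) M → ProbDensity μ) (t t' : Set.Icc (-M) M) :
    Measurable fun y => f t y / f t' y :=
  (f t).measurable_toFun.div (f t').measurable_toFun

theorem ratio_nonneg (f : Set.Icc (-M) M → ProbDensity μ) (t t' : Set.Icc (-M) M) (y : Y) :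
    0 ≤ f t y / f t' y :=
  div_nonneg ((f t).nonneg y) ((f t').nonneg y)

theorem RatioRegularity.exists_integral_rpow_le [CompactSpace X] (hD : RatioRegularity f₀ f)
    (a b : C(X, Set.Icc (-M) M)) {s : ℝ} (hs : 0 < s) :
    ∃ β : ℝ, 0 < β ∧ β ≤ 1 ∧ ∀ z : X, ∫ y, (f (b z) y / f (a z) y) ^ β ∂(f₀ z).law
      ≤ 1 + β * (∫ y, Real.log (f (b z) y / f (a z) y) ∂(f₀ z).law + s) := by
  have hmap : Continuous fun z : X => (z, b z, a z) := by fun_prop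
  have hlog := hD.continuous_log.comp hmap
  have hrpow := fun β hβ => (hD.continuous_rpow β hβ).comp hmap
  simp only [Function.comp_def] at hlog hrpow
  refine exists_integral_rpow_le_of_continuous (P := fun z => (f₀ z).law)
    (g := fun z y => f (b z) y / f (a z) y) (fun z => ?_) (fun z => hD.integrable_log _ _ _)
    hlog (fun β hβ z => hD.integrable_rpow β hβ z _ _)
    hrpow hs
  filter_upwards [hD.ae_pos z (a z), hD.ae_pos z (b z)] with y h1 h2 using div_pos h2 h1

theorem RatioRegularity.lintegral_rpow_eq (hD : RatioRegularity f₀ f) {β : ℝ} (h0 : 0 ≤ β)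
    (h1 : β ≤ 1) (z : X) (t t' : Set.Icc (-M) M) :
    ∫⁻ y, ENNReal.ofReal ((f t y / f t' y) ^ β) ∂(f₀ z).law
      = ENNReal.ofReal (∫ y, (f t y / f t' y) ^ β ∂(f₀ z).law) :=
  (ofReal_integral_eq_lintegral_ofReal (hD.integrable_rpow β ⟨h0, h1⟩ z t t')
    (Eventually.of_forall fun _ => Real.rpow_nonneg (ratio_nonneg f t t' _) _)).symm

theorem RatioRegularity.lintegral_ratio_eq (hD : RatioRegularity f₀ f) (z : X)
    (t t' : Set.Icc (-M) M) :
    ∫⁻ y, ENNReal.ofReal (f t y / f t' y) ∂(f₀ z).law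
      = ENNReal.ofReal (∫ y, (f t y / f t' y) ^ (1 : ℝ) ∂(f₀ z).law) := by
  simpa using hD.lintegral_rpow_eq zero_le_one le_rfl z t t'

/-- Mean likelihood ratios of nearby parameter values are uniformly close to one. -/
theorem RatioRegularity.exists_lintegral_ratio_le [CompactSpace X] (hD : RatioRegularity f₀ f)
    {c : ℝ} (hc : 0 < c) :
    ∃ η > 0, ∀ (z : X) (t t' : Set.Icc (-M) M), dist t t' < η →
      ∫⁻ y, ENNReal.ofReal (f t y / f t' y) ∂(f₀ z).law ≤ ENNReal.ofReal (Real.exp c) := by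
  have hu := CompactSpace.uniformContinuous_of_continuous (hD.continuous_rpow 1 (by simp))
  obtain ⟨η, hη, h⟩ := Metric.uniformContinuous_iff.1 hu c hc
  refine ⟨η, hη, fun z t t' htt => ?_⟩
  rw [hD.lintegral_ratio_eq]
  refine ENNReal.ofReal_le_ofReal ?_
  -- On the diagonal the mean ratio is one; uniform continuity bounds the deviation off it.
  have h1 : ∫ y, (f t' y / f t' y) ^ (1 : ℝ) ∂(f₀ z).law = 1 := by
    rw [integral_congr_ae (g := fun _ => (1 : ℝ))]
    · simp
    · filter_upwards [hD.ae_pos z t'] with y hy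
      simp [div_self hy.ne']
  have h2 := h (a := (z, t, t')) (b := (z, t', t')) (by
    simpa only [Prod.dist_eq, dist_self, dist_nonneg, max_eq_left, max_eq_right] using htt)
  rw [h1, Real.dist_eq] at h2
  linarith [le_abs_self ((∫ y, (f t y / f t' y) ^ (1 : ℝ) ∂(f₀ z).law) - 1), Real.add_one_le_exp c]

/-- A crude bound by compactness, used only for finiteness of the evidence. -/
theorem RatioRegularity.exists_forall_lintegral_ratio_le [CompactSpace X]
    (hD : RatioRegularity f₀ f) :
    ∃ c : ℝ, ∀ (z : X) (t t' : Set.Icc (-M) M),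
      ∫⁻ y, ENNReal.ofReal (f t y / f t' y) ∂(f₀ z).law ≤ ENNReal.ofReal (Real.exp c) := by
  obtain ⟨c, hc⟩ := (isCompact_range (hD.continuous_rpow 1 (by simp))).bddAbove
  refine ⟨c, fun z t t' => ?_⟩
  rw [hD.lintegral_ratio_eq]
  refine ENNReal.ofReal_le_ofReal ?_
  have := hc ⟨(z, t, t'), rfl⟩
  dsimp only at this
  linarith [Real.add_one_le_exp c]

theorem likelihoodRatio_nonneg (a b : C(X, Set.Icc (-M) M)) (n : ℕ) (y : ℕ → Y) :
    0 ≤ likelihoodRatio f x a b n y :=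
  Finset.prod_nonneg fun _ _ => ratio_nonneg f _ _ _

theorem lintegral_likelihoodRatio_le {a b : C(X, Set.Icc (-M) M)} {c : ℝ}
    (h : ∀ z : X, ∫⁻ u, ENNReal.ofReal (f (b z) u / f (a z) u) ∂(f₀ z).law
      ≤ ENNReal.ofReal (Real.exp c)) (n : ℕ) :
    ∫⁻ y, ENNReal.ofReal (likelihoodRatio f x a b n y) ∂trueLaw f₀ x
      ≤ ENNReal.ofReal (Real.exp (n * c)) := by
  simp only [likelihoodRatio]
  simp_rw [ENNReal.ofReal_prod_of_nonneg (fun i _ => ratio_nonneg f _ _ _)]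
  rw [trueLaw, lintegral_prod_infinitePi
    (g := fun i u => ENNReal.ofReal (f (b (x i)) u / f (a (x i)) u))
    (fun i => (measurable_ratio f _ _).ennreal_ofReal)]
  refine (Finset.prod_le_prod' fun i _ => h (x i)).trans ?_
  rw [Finset.prod_const, Finset.card_range, ← ENNReal.ofReal_pow (Real.exp_nonneg _),
    ← Real.exp_nat_mul]

theorem measurable_likelihoodRatio [MeasurableSpace C(X, Set.Icc (-M) M)]
    [BorelSpace C(X, Set.Icc (-M) M)]
    (hf : Measurable fun p : Set.Icc (-M) M × Y => f p.1 p.2)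
    {T : Type*} [MeasurableSpace T] {a b : T → C(X, Set.Icc (-M) M)} (ha : Measurable a)
    (hb : Measurable b) (n : ℕ) :
    Measurable fun p : T × (ℕ → Y) => likelihoodRatio f x (a p.1) (b p.1) n p.2 := by
  unfold likelihoodRatio
  refine Finset.measurable_fun_prod _ fun i _ => ?_
  have he : Measurable fun g : C(X, Set.Icc (-M) M) => g (x i) :=
    (continuous_eval_const (x i)).measurable
  have hy : Measurable fun p : T × (ℕ → Y) => p.2 i :=
    (measurable_pi_apply i).comp measurable_snd
  exact (hf.comp ((he.comp (hb.comp measurable_fst)).prodMk hy)).div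
    (hf.comp ((he.comp (ha.comp measurable_fst)).prodMk hy))

/-- Mixtures of likelihood ratios inherit exponential moment bounds. -/
theorem lintegral_mixture_le [MeasurableSpace C(X, Set.Icc (-M) M)]
    [BorelSpace C(X, Set.Icc (-M) M)]
    (hf : Measurable fun p : Set.Icc (-M) M × Y => f p.1 p.2)
    {T : Type*} [MeasurableSpace T] {ν : Measure T} [SFinite ν]
    {a b : T → C(X, Set.Icc (-M) M)} (ha : Measurable a) (hb : Measurable b) {c : ℝ}
    (h : ∀ᵐ θ ∂ν, ∀ z : X, ∫⁻ u, ENNReal.ofReal (f (b θ z) u / f (a θ z) u) ∂(f₀ z).law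
      ≤ ENNReal.ofReal (Real.exp c)) (n : ℕ) :
    ∫⁻ y, ∫⁻ θ, ENNReal.ofReal (likelihoodRatio f x (a θ) (b θ) n y) ∂ν ∂trueLaw f₀ x
      ≤ ENNReal.ofReal (Real.exp (n * c)) * ν Set.univ := by
  rw [lintegral_lintegral_swap]
  · rw [← lintegral_const]
    refine lintegral_mono_ae ?_
    filter_upwards [h] with θ hθ using lintegral_likelihoodRatio_le hθ n
  · exact ((measurable_likelihoodRatio hf ha hb n).comp measurable_swap).ennreal_ofReal.aemeasurable

theorem measurable_mixture [MeasurableSpace C(X, Set.Icc (-M) M)]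
    [BorelSpace C(X, Set.Icc (-M) M)]
    (hf : Measurable fun p : Set.Icc (-M) M × Y => f p.1 p.2)
    {T : Type*} [MeasurableSpace T] {ν : Measure T} [SFinite ν]
    {a b : T → C(X, Set.Icc (-M) M)} (ha : Measurable a) (hb : Measurable b) (n : ℕ) :
    Measurable fun y => ∫⁻ θ, ENNReal.ofReal (likelihoodRatio f x (a θ) (b θ) n y) ∂ν :=
  (measurable_likelihoodRatio hf ha hb n).ennreal_ofReal.lintegral_prod_left

theorem RatioRegularity.ae_forall_pos (hD : RatioRegularity f₀ f) (a : C(X, Set.Icc (-M) M)) :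
    ∀ᵐ y ∂trueLaw f₀ x, ∀ i : ℕ, 0 < f (a (x i)) (y i) := by
  rw [ae_all_iff]
  intro i
  exact (measurePreserving_eval_infinitePi
    (fun i => (f₀ (x i)).law) i).quasiMeasurePreserving.ae (hD.ae_pos (x i) (a (x i)))

theorem RatioRegularity.ae_likelihoodRatio_pos (hD : RatioRegularity f₀ f)
    (a b : C(X, Set.Icc (-M) M)) :
    ∀ᵐ y ∂trueLaw f₀ x, ∀ n : ℕ, 0 < likelihoodRatio f x a b n y := by
  filter_upwards [hD.ae_forall_pos a, hD.ae_forall_pos b] with y h1 h2 n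
  exact Finset.prod_pos fun i _ => div_pos (h2 i) (h1 i)

/-! ### Kullback-Leibler excess along the design -/

theorem integral_log_ratio_swap (f : Set.Icc (-M) M → ProbDensity μ) (ν : Measure Y)
    (t t' : Set.Icc (-M) M) :
    ∫ y, Real.log (f t y / f t' y) ∂ν = -∫ y, Real.log (f t' y / f t y) ∂ν := by
  rw [← integral_neg]
  simp_rw [← Real.log_inv, inv_div]

/-- A positive mean would put the reversed mean below every `δ`, and separation at `ε = |t - θ* z|`
would then give `ε < ε`, unless `t = θ* z`, where the mean vanishes. -/
theorem KLSeparation.integral_log_nonpos {θstar : C(X, Set.Icc (-M) M)}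
    (hE : KLSeparation f₀ f θstar) (z : X) (t : Set.Icc (-M) M) :
    ∫ y, Real.log (f t y / f (θstar z) y) ∂(f₀ z).law ≤ 0 := by
  by_contra! hcon
  have ht : t = θstar z := by
    by_contra hne
    have hd : 0 < |(t : ℝ) - (θstar z : ℝ)| :=
      abs_pos.2 (sub_ne_zero.2 fun h => hne (Subtype.ext h))
    obtain ⟨δ, hδ, h⟩ := hE _ hd
    exact lt_irrefl _ (h z t (by rw [integral_log_ratio_swap]; linarith [hδ.1]))
  subst ht
  refine hcon.ne ?_
  rw [integral_congr_ae (g := fun _ => (0 : ℝ))]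
  · simp
  -- Where the density vanishes, `0 / 0 = 0` and `Real.log 0 = 0`, so the integrand is zero
  -- everywhere.
  · refine Eventually.of_forall fun y => ?_
    rcases eq_or_ne (f (θstar z) y) 0 with h | h <;> simp [h]

theorem KLSeparation.exists_integral_log_le {θstar : C(X, Set.Icc (-M) M)}
    (hE : KLSeparation f₀ f θstar) {ε : ℝ} (hε : 0 < ε) :
    ∃ δ > 0, ∀ (z : X) (t : Set.Icc (-M) M), ε ≤ |(t : ℝ) - (θstar z : ℝ)| →
      ∫ y, Real.log (f t y / f (θstar z) y) ∂(f₀ z).law ≤ -δ := by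
  obtain ⟨δ, hδ, h⟩ := hE ε hε
  refine ⟨δ, hδ.1, fun z t ht => ?_⟩
  have h1 : δ ≤ ∫ y, Real.log (f (θstar z) y / f t y) ∂(f₀ z).law := by
    by_contra! hcon
    exact (h z t hcon).not_ge ht
  rw [integral_log_ratio_swap]
  linarith

/-- A continuous nonpositive function that is negative somewhere has partial sums along the design
that decrease at a linear rate. -/
theorem DesignCondition.exists_sum_le (hB : DesignCondition x) {φ : X → ℝ} (hφ : Continuous φ)
    (h0 : ∀ z, φ z ≤ 0) {z₀ : X} (hz₀ : φ z₀ < 0) :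
    ∃ κ > 0, ∃ C : ℝ, ∀ n : ℕ, ∑ i ∈ Finset.range n, φ (x i) ≤ -(n * κ) + C := by
  -- With this choice `φ < -δ` on a whole ball around `z₀`.
  set δ := -φ z₀ / 2 with hδ
  have hδ0 : 0 < δ := by linarith
  obtain ⟨r, hr, hball⟩ := Metric.continuous_iff.1 hφ z₀ δ hδ0
  set ind : E → ℝ := Set.indicator {z : E | ‖z - z₀‖ < r} (fun _ => (1 : ℝ)) with hind
  have hφind (z : X) : φ z ≤ -(δ * ind z) := by
    by_cases hz : ‖(z : E) - z₀‖ < r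
    · have h1 : ind z = 1 := Set.indicator_of_mem (s := {z : E | ‖z - z₀‖ < r}) hz _
      have h2 := hball z (by rwa [Subtype.dist_eq, dist_eq_norm])
      rw [Real.dist_eq] at h2
      rw [h1]
      linarith [le_abs_self (φ z - φ z₀)]
    · have h1 : ind z = 0 := Set.indicator_of_notMem (s := {z : E | ‖z - z₀‖ < r}) hz _
      simpa [h1] using h0 z
  obtain ⟨p, hp, hpl⟩ := exists_between (hB z₀ r hr)
  have hev := eventually_lt_of_lt_liminf hpl (isBoundedUnder_of ⟨0, fun n => by
    have : 0 ≤ ∑ i ∈ Finset.range n, ind (x i) :=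
      Finset.sum_nonneg fun i _ => Set.indicator_nonneg (fun _ _ => zero_le_one) _
    positivity⟩)
  obtain ⟨N, hN⟩ := eventually_atTop.1 hev
  -- The constant absorbs all `n ≤ N`, where only nonpositivity of the sum is known; `N + 1` also
  -- ensures `n ≠ 0` when dividing.
  refine ⟨δ * p, by positivity, δ * p * (N + 1), fun n => ?_⟩
  have hκ : 0 < δ * p := by positivity
  rcases lt_or_ge n (N + 1) with hn | hn
  · have h1 : ∑ i ∈ Finset.range n, φ (x i) ≤ 0 := Finset.sum_nonpos fun i _ => h0 _
    have h2 : (n : ℝ) ≤ N + 1 := by exact_mod_cast hn.le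
    nlinarith
  · have h1 : ∑ i ∈ Finset.range n, φ (x i) ≤ -(δ * ∑ i ∈ Finset.range n, ind (x i)) := by
      rw [Finset.mul_sum, ← Finset.sum_neg_distrib]
      exact Finset.sum_le_sum fun i _ => hφind _
    have h2 := hN n (by omega)
    have hn0 : (0 : ℝ) < n := by exact_mod_cast (by omega : 0 < n)
    rw [one_div, inv_mul_eq_div, lt_div_iff₀ hn0] at h2
    have h3 := mul_le_mul_of_nonneg_left h2.le hδ0.le
    have h4 : 0 ≤ δ * p * ((N : ℝ) + 1) := by positivity
    linarith

theorem RatioRegularity.lintegral_likelihoodRatio_rpow (hD : RatioRegularity f₀ f) {β : ℝ}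
    (h0 : 0 ≤ β) (h1 : β ≤ 1) (a b : C(X, Set.Icc (-M) M)) (n : ℕ) :
    ∫⁻ y, ENNReal.ofReal (likelihoodRatio f x a b n y ^ β) ∂trueLaw f₀ x
      = ∏ i ∈ Finset.range n, ENNReal.ofReal
        (∫ u, (f (b (x i)) u / f (a (x i)) u) ^ β ∂(f₀ (x i)).law) := by
  simp_rw [likelihoodRatio, ← Real.finsetProd_rpow _ _ (fun i _ => ratio_nonneg f _ _ _),
    ENNReal.ofReal_prod_of_nonneg (fun i _ => Real.rpow_nonneg (ratio_nonneg f _ _ _) _)]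
  rw [trueLaw, lintegral_prod_infinitePi
    (g := fun i u => ENNReal.ofReal ((f (b (x i)) u / f (a (x i)) u) ^ β))
    (fun i => ((measurable_ratio f _ _).pow_const β).ennreal_ofReal)]
  exact Finset.prod_congr rfl fun i _ => hD.lintegral_rpow_eq h0 h1 _ _ _

theorem measurable_likelihoodRatio_const (f : Set.Icc (-M) M → ProbDensity μ)
    (a b : C(X, Set.Icc (-M) M)) (n : ℕ) : Measurable (likelihoodRatio f x a b n) := by
  unfold likelihoodRatio
  exact Finset.measurable_fun_prod _ fun i _ =>
    (measurable_ratio f _ _).comp (measurable_pi_apply i)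

/-- The likelihood ratio of a parameter other than `θ*` decays exponentially fast. -/
theorem exists_ae_tendsto_exp_mul_likelihoodRatio [CompactSpace X] (hB : DesignCondition x)
    {θstar : C(X, Set.Icc (-M) M)} (hD : RatioRegularity f₀ f) (hE : KLSeparation f₀ f θstar)
    {θ : C(X, Set.Icc (-M) M)} (hne : θ ≠ θstar) :
    ∃ κ > 0, ∀ᵐ y ∂trueLaw f₀ x, Tendsto (fun n : ℕ => ENNReal.ofReal (Real.exp (n * κ)) *
      ENNReal.ofReal (likelihoodRatio f x θstar θ n y)) atTop (𝓝 0) := by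
  obtain ⟨z₀, hz₀⟩ : ∃ z, θ z ≠ θstar z := by
    by_contra! h
    exact hne (ContinuousMap.ext h)
  obtain ⟨δ, hδ, hsep⟩ := hE.exists_integral_log_le
    (abs_pos.2 (sub_ne_zero.2 fun h => hz₀ (Subtype.ext h)))
  have hcont : Continuous fun z : X => ∫ y, Real.log (f (θ z) y / f (θstar z) y) ∂(f₀ z).law := by
    have hmap : Continuous fun z : X => (z, θ z, θstar z) := by fun_prop
    have h := hD.continuous_log.comp hmap
    simpa only [Function.comp_def] using h
  obtain ⟨κ, hκ, C, hsum⟩ := hB.exists_sum_le hcont (fun z => hE.integral_log_nonpos z _)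
    (z₀ := z₀) ((hsep z₀ _ le_rfl).trans_lt (neg_lt_zero.2 hδ))
  obtain ⟨β, hβ, hβ1, hmom⟩ := hD.exists_integral_rpow_le θstar θ (s := κ / 4) (by positivity)
  refine ⟨κ / 2, by positivity, ?_⟩
  -- The moments decay at rate `β (κ - κ/4)`; giving up another `κ/4` leaves room for
  -- Borel-Cantelli.
  have hbc := ae_tendsto_exp_mul_of_lintegral_le (P := trueLaw f₀ x)
    (F := fun n y => ENNReal.ofReal (likelihoodRatio f x θstar θ n y ^ β))
    (fun n => ((measurable_likelihoodRatio_const f _ _ n).pow_const β).ennreal_ofReal)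
    (C := ENNReal.ofReal (Real.exp (β * C))) ENNReal.ofReal_ne_top
    (a := -(β * (3 * κ / 4))) (b := -(β * (κ / 2))) (by nlinarith [mul_pos hβ hκ]) fun n => by
      rw [hD.lintegral_likelihoodRatio_rpow hβ.le hβ1]
      refine (Finset.prod_le_prod' fun i _ => ENNReal.ofReal_le_ofReal
        ((hmom (x i)).trans ((add_comm _ _).trans_le (Real.add_one_le_exp _)))).trans ?_
      rw [← ENNReal.ofReal_prod_of_nonneg (fun i _ => Real.exp_nonneg _), ← Real.exp_sum,
        ← ENNReal.ofReal_mul (Real.exp_nonneg _), ← Real.exp_add, ← Finset.mul_sum,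
        Finset.sum_add_distrib, Finset.sum_const, Finset.card_range, nsmul_eq_mul]
      refine ENNReal.ofReal_le_ofReal (Real.exp_le_exp.2 ?_)
      have := mul_le_mul_of_nonneg_left (hsum n) hβ.le
      linarith
  filter_upwards [hbc] with y hy
  -- Taking the power `β⁻¹` returns from `L ^ β` to `L`, and from rate `β κ/2` to `κ/2`.
  have ht := (ENNReal.continuous_rpow_const (y := β⁻¹)).tendsto 0 |>.comp hy
  rw [ENNReal.zero_rpow_of_pos (inv_pos.2 hβ)] at ht
  refine ht.congr fun n => ?_
  have hL := likelihoodRatio_nonneg (f := f) (x := x) θstar θ n y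
  have he : Real.exp (-(n * -(β * (κ / 2)))) = Real.exp (n * (κ / 2)) ^ β := by
    rw [← Real.exp_mul]; congr 1; ring
  rw [Function.comp_apply, he, ← ENNReal.ofReal_mul (by positivity),
    ← Real.mul_rpow (Real.exp_nonneg _) hL,
    ENNReal.ofReal_rpow_of_nonneg (by positivity) (inv_nonneg.2 hβ.le),
    Real.rpow_rpow_inv (by positivity) hβ.ne', ENNReal.ofReal_mul (Real.exp_nonneg _)]

/-! ### Algebra of likelihood ratios and the sup-norm distance -/

theorem likelihoodRatio_eq_mul {a b c : C(X, Set.Icc (-M) M)} {y : ℕ → Y}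
    (hb : ∀ i, 0 < f (b (x i)) (y i)) (n : ℕ) :
    likelihoodRatio f x a c n y = likelihoodRatio f x a b n y * likelihoodRatio f x b c n y := by
  simp_rw [likelihoodRatio, ← Finset.prod_mul_distrib]
  refine Finset.prod_congr rfl fun i _ => ?_
  rw [mul_comm, div_mul_div_cancel₀ (hb i).ne']

theorem likelihoodRatio_inv (a b : C(X, Set.Icc (-M) M)) (n : ℕ) (y : ℕ → Y) :
    (likelihoodRatio f x a b n y)⁻¹ = likelihoodRatio f x b a n y := by
  simp_rw [likelihoodRatio, ← Finset.prod_inv_distrib, inv_div]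

theorem dist_le_supDist [CompactSpace X] (θ θ' : C(X, Set.Icc (-M) M)) :
    dist θ θ' ≤ supDist θ θ' := by
  refine (ContinuousMap.dist_le (Real.iSup_nonneg fun _ => abs_nonneg _)).2 fun z => ?_
  rw [Subtype.dist_eq, Real.dist_eq]
  refine le_ciSup (f := fun z : X => |(θ z : ℝ) - (θ' z : ℝ)|) ⟨dist θ θ', ?_⟩ z
  rintro _ ⟨w, rfl⟩
  simpa only [Subtype.dist_eq, Real.dist_eq] using ContinuousMap.dist_apply_le_dist (f := θ) (g := θ') w

theorem supDist_le_dist [CompactSpace X] (θ θ' : C(X, Set.Icc (-M) M)) :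
    supDist θ θ' ≤ dist θ θ' :=
  Real.iSup_le (fun z => by
    simpa only [Subtype.dist_eq, Real.dist_eq] using
      ContinuousMap.dist_apply_le_dist (f := θ) (g := θ') z) dist_nonneg

/-! ### Decay of the evidence away from `θ*` and its lower bound near `θ*` -/

section Posterior

variable [MeasurableSpace C(X, Set.Icc (-M) M)] [BorelSpace C(X, Set.Icc (-M) M)]
  {Θ : Set C(X, Set.Icc (-M) M)} {prior : Measure Θ}

/-- Every parameter other than `θ*` has a neighbourhood whose evidence decays exponentially. -/
theorem exists_nhds_ae_tendsto_exp_mul_partialEvidence [CompactSpace X] [IsFiniteMeasure prior]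
    (hf : Measurable fun p : Set.Icc (-M) M × Y => f p.1 p.2)
    (hB : DesignCondition x) {θstar : Θ} (hD : RatioRegularity f₀ f)
    (hE : KLSeparation f₀ f θstar) {θ₁ : Θ} (hne : θ₁ ≠ θstar) :
    ∃ S ∈ 𝓝 θ₁, ∃ c > 0, ∀ᵐ y ∂trueLaw f₀ x, Tendsto (fun n : ℕ =>
      ENNReal.ofReal (Real.exp (n * c)) * partialEvidence f x prior θstar S n y) atTop (𝓝 0) := by
  obtain ⟨κ, hκ, hsingle⟩ := exists_ae_tendsto_exp_mul_likelihoodRatio hB hD hE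
    (θ := θ₁) (fun h => hne (Subtype.ext h))
  obtain ⟨η, hη, hratio⟩ := hD.exists_lintegral_ratio_le (c := κ / 4) (by positivity)
  refine ⟨Metric.ball θ₁ η, Metric.ball_mem_nhds _ hη, κ / 2, by positivity, ?_⟩
  -- The mixture re-centred at `θ₁` has mean growing at rate at most `κ/4`, hence is almost surely
  -- `o(exp (n κ/2))`; against the decay rate `κ` of the ratio at `θ₁` this leaves `κ/2`.
  have hmix := ae_tendsto_exp_mul_of_lintegral_le (P := trueLaw f₀ x)
    (measurable_mixture hf (ν := prior.restrict (Metric.ball θ₁ η))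
      (a := fun _ => (θ₁ : C(X, Set.Icc (-M) M))) (b := fun θ => θ) measurable_const
      measurable_subtype_coe) (measure_ne_top (prior.restrict (Metric.ball θ₁ η)) Set.univ)
    (a := κ / 4) (b := κ / 2) (by linarith)
    (lintegral_mixture_le hf measurable_const measurable_subtype_coe
      ((ae_restrict_iff' Metric.isOpen_ball.measurableSet).2 (Eventually.of_forall fun θ hθ z =>
        hratio z _ _ ((ContinuousMap.dist_apply_le_dist z).trans_lt hθ))))
  filter_upwards [hsingle, hmix, hD.ae_forall_pos (x := x) (θ₁ : C(X, Set.Icc (-M) M))]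
    with y h1 h2 hpos
  have h3 := ENNReal.Tendsto.mul h1 (Or.inr ENNReal.zero_ne_top) h2 (Or.inr ENNReal.zero_ne_top)
  rw [zero_mul] at h3
  refine h3.congr fun n => ?_
  have hfac : partialEvidence f x prior θstar (Metric.ball θ₁ η) n y
      = ENNReal.ofReal (likelihoodRatio f x θstar θ₁ n y) * ∫⁻ θ in Metric.ball θ₁ η,
        ENNReal.ofReal (likelihoodRatio f x θ₁ (θ : Θ) n y) ∂prior := by
    rw [← lintegral_const_mul' _ _ ENNReal.ofReal_ne_top]
    refine lintegral_congr fun θ => ?_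
    rw [← ENNReal.ofReal_mul (likelihoodRatio_nonneg _ _ _ _), ← likelihoodRatio_eq_mul hpos]
  rw [hfac, mul_mul_mul_comm,
    ← ENNReal.ofReal_mul (Real.exp_nonneg _), ← Real.exp_add]
  congr 3
  ring

theorem ae_tendsto_exp_mul_mono {F G : ℕ → (ℕ → Y) → ℝ≥0∞} {P : Measure (ℕ → Y)} {c c' : ℝ}
    (hFG : ∀ n y, F n y ≤ G n y) (hc : c ≤ c')
    (h : ∀ᵐ y ∂P, Tendsto (fun n : ℕ => ENNReal.ofReal (Real.exp (n * c')) * G n y) atTop (𝓝 0)) :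
    ∀ᵐ y ∂P, Tendsto (fun n : ℕ => ENNReal.ofReal (Real.exp (n * c)) * F n y) atTop (𝓝 0) := by
  filter_upwards [h] with y hy
  refine tendsto_of_tendsto_of_tendsto_of_le_of_le tendsto_const_nhds hy (fun _ => zero_le)
    fun n => ?_
  dsimp only
  gcongr
  exact hFG n y

/-- The evidence of a compact set not containing `θ*` decays exponentially fast. -/
theorem exists_ae_tendsto_exp_mul_partialEvidence [CompactSpace X] [IsFiniteMeasure prior]
    (hf : Measurable fun p : Set.Icc (-M) M × Y => f p.1 p.2)
    (hB : DesignCondition x) {θstar : Θ} (hD : RatioRegularity f₀ f)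
    (hE : KLSeparation f₀ f θstar) {K : Set Θ} (hK : IsCompact K) (hK' : θstar ∉ K) :
    ∃ c > 0, ∀ᵐ y ∂trueLaw f₀ x, Tendsto (fun n : ℕ =>
      ENNReal.ofReal (Real.exp (n * c)) * partialEvidence f x prior θstar K n y) atTop (𝓝 0) := by
  -- Exponential decay passes to subsets and to unions of two sets (with the smaller rate), so local
  -- decay suffices and only finitely many null sets are combined.
  refine hK.induction_on (p := fun S => ∃ c > 0, ∀ᵐ y ∂trueLaw f₀ x, Tendsto (fun n : ℕ =>
    ENNReal.ofReal (Real.exp (n * c)) * partialEvidence f x prior θstar S n y) atTop (𝓝 0))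
    ⟨1, one_pos, by simp [partialEvidence]⟩ ?_ ?_ ?_
  · rintro S T hST ⟨c, hc, h⟩
    exact ⟨c, hc, ae_tendsto_exp_mul_mono (fun n y => lintegral_mono_set hST) le_rfl h⟩
  · rintro S T ⟨c, hc, h⟩ ⟨c', hc', h'⟩
    refine ⟨min c c', lt_min hc hc', ?_⟩
    filter_upwards [ae_tendsto_exp_mul_mono (fun _ _ => le_rfl) (min_le_left c c') h,
      ae_tendsto_exp_mul_mono (fun _ _ => le_rfl) (min_le_right c c') h'] with y hy hy'
    have hadd := hy.add hy'
    rw [add_zero] at hadd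
    refine tendsto_of_tendsto_of_tendsto_of_le_of_le tendsto_const_nhds hadd (fun _ => zero_le)
      fun n => ?_
    dsimp only
    rw [← mul_add]
    gcongr
    exact lintegral_union_le _ _ _
  · intro θ₁ hθ₁
    obtain ⟨S, hS, h⟩ := exists_nhds_ae_tendsto_exp_mul_partialEvidence (prior := prior) hf hB hD hE
      (θ₁ := θ₁) (fun h => hK' (h ▸ hθ₁))
    exact ⟨S, mem_nhdsWithin_of_mem_nhds hS, h⟩

theorem measurable_ofReal_likelihoodRatio
    (hf : Measurable fun p : Set.Icc (-M) M × Y => f p.1 p.2) (θstar : Θ) (n : ℕ) (y : ℕ → Y) :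
    Measurable fun θ : Θ => ENNReal.ofReal (likelihoodRatio f x θstar θ n y) :=
  ((measurable_likelihoodRatio (a := fun _ : Θ => (θstar : C(X, Set.Icc (-M) M)))
    (b := fun θ : Θ => (θ : C(X, Set.Icc (-M) M))) hf measurable_const measurable_subtype_coe
    n).comp (measurable_prodMk_right (y := y))).ennreal_ofReal

/-- For fixed `θ` the exceptional null set of data depends on `θ`; Fubini on the jointly measurable
positivity set exchanges the two quantifiers. -/
theorem ae_ae_likelihoodRatio_pos [SFinite prior]
    (hf : Measurable fun p : Set.Icc (-M) M × Y => f p.1 p.2) (hD : RatioRegularity f₀ f)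
    (θstar : Θ) :
    ∀ᵐ y ∂trueLaw f₀ x, ∀ᵐ θ ∂prior, ∀ n, 0 < likelihoodRatio f x θstar (θ : Θ) n y := by
  have hset : MeasurableSet {p : Θ × (ℕ → Y) |
      ∀ n, 0 < likelihoodRatio f x θstar (p.1 : Θ) n p.2} := by
    rw [Set.ofPred_forall]
    exact MeasurableSet.iInter fun n => measurableSet_lt measurable_const
      (measurable_likelihoodRatio (a := fun _ : Θ => (θstar : C(X, Set.Icc (-M) M)))
        (b := fun θ : Θ => (θ : C(X, Set.Icc (-M) M))) hf measurable_const
        measurable_subtype_coe n)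
  exact (Measure.ae_ae_comm hset).1
    (Eventually.of_forall fun θ => hD.ae_likelihoodRatio_pos _ _)

/-- The total evidence decays slower than every exponential. -/
theorem exists_ae_eventually_le_exp_mul_partialEvidence [CompactSpace X] [IsFiniteMeasure prior]
    (hf : Measurable fun p : Set.Icc (-M) M × Y => f p.1 p.2) {θstar : Θ}
    (hsupp : InSupNormSupport prior θstar) (hD : RatioRegularity f₀ f) {c : ℝ} (hc : 0 < c) :
    ∃ q : ℝ≥0∞, q ≠ 0 ∧ ∀ᵐ y ∂trueLaw f₀ x, ∀ᶠ n : ℕ in atTop,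
      q ≤ ENNReal.ofReal (Real.exp (n * c)) *
        partialEvidence f x prior θstar Set.univ n y := by
  obtain ⟨η, hη, hratio⟩ := hD.exists_lintegral_ratio_le (c := c / 2) (by positivity)
  set B : Set Θ := Metric.ball θstar η
  have hBpos : 0 < prior B := (hsupp η hη).trans_le
    (measure_mono fun θ hθ => (dist_le_supDist _ _).trans_lt hθ)
  refine ⟨prior B / 2, (ENNReal.half_pos hBpos.ne').ne', ?_⟩
  have hmix := ae_tendsto_exp_mul_of_lintegral_le (P := trueLaw f₀ x)
    (measurable_mixture hf (ν := prior.restrict B) (a := fun θ => θ)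
      (b := fun _ => (θstar : C(X, Set.Icc (-M) M))) measurable_subtype_coe measurable_const)
    (measure_ne_top (prior.restrict B) Set.univ)
    (a := c / 2) (b := c) (by linarith)
    (lintegral_mixture_le hf measurable_subtype_coe measurable_const
      ((ae_restrict_iff' Metric.isOpen_ball.measurableSet).2 (Eventually.of_forall fun θ hθ z =>
        hratio z _ _ ((ContinuousMap.dist_apply_le_dist z).trans_lt (Metric.mem_ball'.1 hθ)))))
  filter_upwards [hmix, ae_ae_likelihoodRatio_pos (prior := prior) hf hD θstar] with y hy hpos
  filter_upwards [hy.eventually_lt_const (ENNReal.half_pos hBpos.ne')] with n hn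
  -- Integrate `1 ≤ u + u⁻¹` over `B`, with `u = exp (n c)` times the likelihood ratio. The inverse
  -- part is eventually below `prior B / 2`, so the evidence part cannot be.
  have hsplit : prior B ≤ ENNReal.ofReal (Real.exp (n * c)) *
      partialEvidence f x prior θstar B n y + ENNReal.ofReal (Real.exp (-(n * c))) *
        ∫⁻ θ in B, ENNReal.ofReal (likelihoodRatio f x (θ : Θ) θstar n y) ∂prior := by
    rw [partialEvidence, ← lintegral_const_mul' _ _ ENNReal.ofReal_ne_top,
      ← lintegral_const_mul' _ _ ENNReal.ofReal_ne_top, ← lintegral_add_left]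
    · rw [← setLIntegral_one]
      refine lintegral_mono_ae ?_
      filter_upwards [ae_restrict_of_ae hpos] with θ hθ
      have hθ := hθ n
      rw [← likelihoodRatio_inv (θstar : C(X, Set.Icc (-M) M)), ← ENNReal.ofReal_mul (Real.exp_nonneg _),
        ← ENNReal.ofReal_mul (Real.exp_nonneg _), Real.exp_neg, ← mul_inv,
        ← ENNReal.ofReal_add (by positivity) (by positivity), ENNReal.one_le_ofReal]
      set u := Real.exp (n * c) * likelihoodRatio f x θstar θ n y
      have hu : 0 < u := by positivity
      rcases le_total 1 u with h | h
      · linarith [inv_pos.2 hu]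
      · linarith [(one_le_inv₀ hu).2 h]
    · exact (measurable_ofReal_likelihoodRatio hf θstar n y).const_mul _
  by_contra! hlt
  have hle : ENNReal.ofReal (Real.exp (n * c)) * partialEvidence f x prior θstar B n y
      < prior B / 2 := by
    refine lt_of_le_of_lt ?_ hlt
    gcongr
    exact lintegral_mono_set (Set.subset_univ B)
  exact (hsplit.trans_lt (ENNReal.add_lt_add hle hn)).ne (ENNReal.add_halves _).symm

theorem ae_partialEvidence_univ_pos [SFinite prior] [NeZero prior]
    (hf : Measurable fun p : Set.Icc (-M) M × Y => f p.1 p.2) (hD : RatioRegularity f₀ f)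
    (θstar : Θ) :
    ∀ᵐ y ∂trueLaw f₀ x, ∀ n, 0 < partialEvidence f x prior θstar Set.univ n y := by
  filter_upwards [ae_ae_likelihoodRatio_pos (prior := prior) hf hD θstar] with y hy n
  rw [partialEvidence, Measure.restrict_univ, pos_iff_ne_zero, Ne, lintegral_eq_zero_iff
    (measurable_ofReal_likelihoodRatio hf θstar n y)]
  intro h0
  obtain ⟨θ, h1, h2⟩ := (h0.and hy).exists
  exact (ENNReal.ofReal_pos.2 (h2 n)).ne' h1

theorem ae_partialEvidence_univ_lt_top [CompactSpace X] [IsFiniteMeasure prior]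
    (hf : Measurable fun p : Set.Icc (-M) M × Y => f p.1 p.2) (hD : RatioRegularity f₀ f)
    (θstar : Θ) :
    ∀ᵐ y ∂trueLaw f₀ x, ∀ n, partialEvidence f x prior θstar Set.univ n y < ∞ := by
  obtain ⟨c, hc⟩ := hD.exists_forall_lintegral_ratio_le
  rw [ae_all_iff]
  intro n
  simp_rw [partialEvidence, Measure.restrict_univ]
  refine ae_lt_top (measurable_mixture hf measurable_const measurable_subtype_coe n)
    (ne_top_of_le_ne_top ?_ (lintegral_mixture_le hf measurable_const measurable_subtype_coe
      (Eventually.of_forall fun θ z => hc z _ _) n))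
  exact ENNReal.mul_ne_top ENNReal.ofReal_ne_top (measure_ne_top _ _)

end Posterior

end Model

end INID

/-! ### Posterior consistency -/

theorem mainTheorem11
    {E : Type*} [NormedAddCommGroup E] [NormedSpace ℝ E] (X : Set E) [CompactSpace X]
    {Y : Type*} [MeasurableSpace Y] (μ : Measure Y) [SigmaFinite μ] (M : ℝ)
    (f₀ : X → ProbDensity μ) (f : Set.Icc (-M) M → ProbDensity μ)
    (hf : Measurable fun p : Set.Icc (-M) M × Y => f p.1 p.2)
    [MeasurableSpace C(X, Set.Icc (-M) M)] [BorelSpace C(X, Set.Icc (-M) M)]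
    (Θ : Set C(X, Set.Icc (-M) M)) (hΘ : IsCompact Θ)
    (prior : Measure Θ) [IsProbabilityMeasure prior]
    (x : ℕ → X) (hB : INID.DesignCondition x)
    (θstar : Θ) (hCmin : INID.IsKLMinimizer f₀ f θstar)
    (hCsupp : INID.InSupNormSupport prior θstar)
    (hD : INID.RatioRegularity f₀ f)
    (hE : INID.KLSeparation f₀ f θstar)
    (ε : ℝ) (hε : 0 < ε) :
    ∀ᵐ y ∂INID.trueLaw f₀ x,
      (∀ n : ℕ, 0 < INID.partialEvidence f x prior θstar Set.univ n y ∧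
        INID.partialEvidence f x prior θstar Set.univ n y < ∞) ∧
      Tendsto (fun n : ℕ => INID.posterior f x prior θstar
          {θ : Θ | ε < INID.supDist (θ : C(X, Set.Icc (-M) M)) θstar} n y)
        atTop (𝓝 0) := by
  have : CompactSpace Θ := isCompact_iff_compactSpace.1 hΘ
  obtain ⟨c, hc, hnum⟩ := INID.exists_ae_tendsto_exp_mul_partialEvidence (prior := prior) hf hB hD hE
    -- The non-strict inequality makes this set closed, hence compact, while it contains the set in
    -- question and omits `θ*`.
    (K := {θ : Θ | ε ≤ dist θ θstar})
    (isClosed_le continuous_const (continuous_id.dist continuous_const)).isCompact (by simp [hε])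
  -- The denominator bound is taken at the numerator's own rate `c`, so that `exp (n c)` cancels in
  -- the quotient.
  obtain ⟨q, hq, hden⟩ := INID.exists_ae_eventually_le_exp_mul_partialEvidence (x := x) hf hCsupp hD hc
  filter_upwards [hnum, hden, INID.ae_partialEvidence_univ_pos (prior := prior) hf hD θstar,
    INID.ae_partialEvidence_univ_lt_top (prior := prior) hf hD θstar] with y hN hDen h0 h1
  refine ⟨fun n => ⟨h0 n, h1 n⟩, ?_⟩
  have hlim := ENNReal.Tendsto.div_const hN (Or.inr hq)
  rw [ENNReal.zero_div] at hlim
  refine tendsto_of_tendsto_of_tendsto_of_le_of_le' tendsto_const_nhds hlim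
    (Eventually.of_forall fun _ => zero_le) ?_
  filter_upwards [hDen] with n hn
  rw [INID.posterior, ← ENNReal.mul_div_mul_left _ _
    (ENNReal.ofReal_pos.2 (Real.exp_pos (n * c))).ne' ENNReal.ofReal_ne_top]
  refine ENNReal.div_le_div (mul_le_mul_right (lintegral_mono_set fun θ hθ => ?_) _) hn
  exact (le_of_lt hθ).trans (INID.supDist_le_dist _ _)
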